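/- Let $(\mathcal X,\mathsf d)$ be a separable metric space with Borel $\sigma$-algebra $\mathfrak B(\mathcal X)$, let $\mu$ be a Borel probability measure on $\mathcal X\times\{0,1\}$ with first marginal $\rho$ (that is, $\rho(A)=\mu(A\times\{0,1\})$), and let $\varepsilon>0$. Write $B_r(x)=\{\tilde x\in\mathcal X:\mathsf d(x,\tilde x)<r\}$ for open balls and $\operatorname{supp}$ for the support of a measure (the set of points all of whose neighbourhoods have positive measure). Assume that there is a finite Borel measure $\nu$ on $\mathcal X$ such that 1. $\rho\ll\nu$; 2. $\{x\in\mathcal X:\operatorname{dist}(x,\operatorname{supp}\rho)<\varepsilon\}\subseteq\operatorname{supp}\nu$; 3. $\nu$ is locally doubling, i.e. $\displaystyle\limsup_{r\downarrow0}\frac{\nu(B_{2r}(x))}{\nu(B_r(x))}<\infty$ for $\nu$-almost every $x\in\mathcal X$. Then the adversarial training problem $$\inf_{A\in\mathfrak B(\mathcal X)}\mathbb E_{(x,y)\sim\mu}\Big[\sup_{\tilde x\in B_\varepsilon(x)}|1_A(\tilde x)-y|\Big]$$ has a minimizer: there is a set $A\in\mathfrak B(\mathcal X)$ at which the infimum is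 attained. -/

import Mathlib

open MeasureTheory Filter Topology

/-- The worst loss `sup_{z ∈ B_ε(x)} |1_A(z) - y|` that an adversary with budget `ε` can force at the
data point `x` with label `y ∈ {0, 1}` upon the classifier `1_A`; `B_ε(x)` is the open ball.
For `0 < ε` the index set is nonempty, and all values lie in `[0, 1]`. -/
noncomputable def adversarialLoss {X : Type*} [MetricSpace X] (ε : ℝ) (A : Set X)
    (p : X × Fin 2) : ℝ :=
  ⨆ z : Metric.ball p.1 ε, |A.indicator (fun _ => (1 : ℝ)) z - ((p.2 : ℕ) : ℝ)|

/-- The adversarial risk `E_{(x,y) ∼ μ} [sup_{z ∈ B_ε(x)} |1_A(z) - y|]`. -/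
noncomputable def adversarialRisk {X : Type*} [MetricSpace X] [MeasurableSpace X] (ε : ℝ)
    (μ : Measure (X × Fin 2)) (A : Set X) : ℝ :=
  ∫ p, adversarialLoss ε A p ∂μ

/-- `ν` is locally doubling (a Vitali measure):
`limsup_{r ↓ 0} ν(B_{2r}(x)) / ν(B_r(x)) < ∞` for `ν`-a.e. `x`, with open balls. -/
def IsLocallyDoubling {X : Type*} [MetricSpace X] [MeasurableSpace X] (ν : Measure X) : Prop :=
  ∀ᵐ x ∂ν, limsup (fun r : ℝ => ν (Metric.ball x (2 * r)) / ν (Metric.ball x r)) (𝓝[>] 0) < ⊤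

lemma adversarialLoss_term_mem {X : Type*} (A : Set X) (z : X) (y : Fin 2) :
    |A.indicator (fun _ => (1 : ℝ)) z - ((y : ℕ) : ℝ)| ∈ Set.Icc (0 : ℝ) 1 := by
  classical
  by_cases h : z ∈ A <;> fin_cases y <;> simp [h]

lemma adversarialLoss_mem {X : Type*} [MetricSpace X] (ε : ℝ) (A : Set X) (p : X × Fin 2) :
    adversarialLoss ε A p ∈ Set.Icc (0 : ℝ) 1 :=
  ⟨Real.iSup_nonneg fun z => (adversarialLoss_term_mem A z p.2).1,
    Real.iSup_le (fun z => (adversarialLoss_term_mem A z p.2).2) zero_le_one⟩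

/-- For each label, the adversarial loss is a lower semicontinuous function of the data point. -/
lemma measurable_adversarialLoss {X : Type*} [MetricSpace X] [MeasurableSpace X] [BorelSpace X]
    (ε : ℝ) (A : Set X) : Measurable (adversarialLoss ε A) := by
  refine measurable_from_prod_countable_left fun y => ?_
  refine measurable_of_Ioi fun t => ?_
  rcases lt_or_ge t 0 with ht | ht
  · convert MeasurableSet.univ
    ext x
    simpa using lt_of_lt_of_le ht (adversarialLoss_mem ε A (x, y)).1
  · have h : (fun x => adversarialLoss ε A (x, y)) ⁻¹' Set.Ioi t =
        ⋃ z ∈ {z : X | t < |A.indicator (fun _ => (1 : ℝ)) z - ((y : ℕ) : ℝ)|},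
          Metric.ball z ε := by
      ext x
      have hb : BddAbove (Set.range fun z : Metric.ball x ε =>
          |A.indicator (fun _ => (1 : ℝ)) (z : X) - ((y : ℕ) : ℝ)|) :=
        ⟨1, by rintro _ ⟨z, rfl⟩; exact (adversarialLoss_term_mem A z y).2⟩
      simp only [Set.mem_preimage, Set.mem_Ioi, Set.mem_iUnion, Set.mem_ofPred_eq, exists_prop]
      constructor
      · intro hx
        by_contra hc
        push Not at hc
        refine absurd hx (not_lt.2 (Real.iSup_le (fun z => ?_) ht))
        by_contra hz
        exact hc z (not_le.1 hz) (Metric.mem_ball_comm.1 z.2)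
      · rintro ⟨z, hz, hxz⟩
        exact lt_of_lt_of_le hz (le_ciSup hb ⟨z, Metric.mem_ball_comm.1 hxz⟩)
    rw [h]
    exact (isOpen_biUnion fun z _ => Metric.isOpen_ball).measurableSet

/-- The adversarial risk is a genuine integral. -/
lemma integrable_adversarialLoss {X : Type*} [MetricSpace X] [MeasurableSpace X] [BorelSpace X]
    (ε : ℝ) (μ : Measure (X × Fin 2)) [IsFiniteMeasure μ] (A : Set X) :
    Integrable (adversarialLoss ε A) μ :=
  Integrable.of_bound (measurable_adversarialLoss ε A).aestronglyMeasurable 1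
    (Eventually.of_forall fun p => by
      rw [Real.norm_eq_abs, abs_of_nonneg (adversarialLoss_mem ε A p).1]
      exact (adversarialLoss_mem ε A p).2)

/-!
The adversarial loss takes only the values `0` and `1`: it is `1` at `(x, y)` exactly when the open
ball `B_ε(x)` contains a misclassified point (`adversarialLoss_eq_one`, `adversarialLoss_eq_zero`).
Since the balls are open, this can be tested on a countable dense set `D`, which makes the direct
method work with pointwise convergence on `D`.

Given sets `A n` whose risks tend to the infimum, compactness of `{0, 1}^D` yields a subsequence
along which membership of every `d ∈ D` stabilises; let `S ⊆ D` be the limiting set. The minimizer is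
`closure S`. An open ball that meets `closure S` meets `S`, and an open ball that meets the open set
`(closure S)ᶜ` contains a point of `D` outside `S`. Either point is misclassified by `A n` for all
large `n` of the subsequence, so the loss of `closure S` is eventually at most that of `A n`
(`exists_isClosed_subseq_adversarialLoss_le`). Dominated convergence turns this into lower
semicontinuity of the risk (`adversarialRisk_le_of_tendsto`).

The argument is purely topological and gives a closed minimizer for every finite measure on a
separable space (`exists_isClosed_adversarialRisk_le`).
-/

/-- A point of the ball on which `1_A` errs, that is `z ∈ A` with label `0` or `z ∉ A` with
label `1`, makes the loss maximal. -/
lemma adversarialLoss_eq_one {X : Type*} [MetricSpace X] {ε : ℝ} {A : Set X} {x : X} {y : Fin 2}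
    {z : X} (hz : z ∈ Metric.ball x ε) (h : z ∈ A ↔ y = 0) : adversarialLoss ε A (x, y) = 1 := by
  classical
  refine le_antisymm (adversarialLoss_mem ε A (x, y)).2 ?_
  have hb : BddAbove (Set.range fun z : Metric.ball x ε =>
      |A.indicator (fun _ => (1 : ℝ)) (z : X) - ((y : ℕ) : ℝ)|) :=
    ⟨1, by rintro _ ⟨z, rfl⟩; exact (adversarialLoss_term_mem A z y).2⟩
  refine le_trans (le_of_eq ?_) (le_ciSup hb ⟨z, hz⟩)
  fin_cases y <;> simp_all

lemma adversarialLoss_eq_zero {X : Type*} [MetricSpace X] {ε : ℝ} {A : Set X} {x : X} {y : Fin 2}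
    (h : ∀ z ∈ Metric.ball x ε, ¬(z ∈ A ↔ y = 0)) : adversarialLoss ε A (x, y) = 0 := by
  classical
  refine le_antisymm (Real.iSup_le (fun z => le_of_eq ?_) le_rfl) (adversarialLoss_mem ε A (x, y)).1
  have := h z z.2
  fin_cases y <;> simp_all

/-- Sequential compactness of the family of all sets for the adversarial loss: along a subsequence,
the loss of some closed set is eventually dominated, at every data point. -/
lemma exists_isClosed_subseq_adversarialLoss_le {X : Type*} [MetricSpace X]
    [TopologicalSpace.SeparableSpace X] (ε : ℝ) (A : ℕ → Set X) :
    ∃ C : Set X, IsClosed C ∧ ∃ φ : ℕ → ℕ, StrictMono φ ∧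
      ∀ p, ∀ᶠ n in atTop, adversarialLoss ε C p ≤ adversarialLoss ε (A (φ n)) p := by
  classical
  obtain ⟨D, hDc, hDd⟩ := TopologicalSpace.exists_countable_dense X
  have : Countable D := hDc
  obtain ⟨u, φ, hφ, hu⟩ := CompactSpace.tendsto_subseq (fun n (d : D) => decide ((d : X) ∈ A n))
  have hmem (d : D) : ∀ᶠ n in atTop, ((d : X) ∈ A (φ n) ↔ u d = true) := by
    have h := tendsto_pi_nhds.1 hu d
    rw [nhds_discrete, tendsto_pure] at h
    filter_upwards [h] with n hn
    rw [← hn]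
    simp
  let S : Set X := {x | ∃ d : D, (d : X) = x ∧ u d = true}
  refine ⟨closure S, isClosed_closure, φ, hφ, fun ⟨x, y⟩ => ?_⟩
  by_cases hx : ∃ z ∈ Metric.ball x ε, (z ∈ closure S ↔ y = 0)
  · obtain ⟨z, hz, hzy⟩ := hx
    -- The misclassified point can be moved into `D`.
    obtain ⟨d, hd, hdy⟩ : ∃ d : D, (d : X) ∈ Metric.ball x ε ∧ (u d = true ↔ y = 0) := by
      by_cases hy : y = 0
      · obtain ⟨_, hw, d, rfl, hd⟩ := mem_closure_iff.1 (hzy.2 hy) _ Metric.isOpen_ball hz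
        exact ⟨d, hw, by simp [hd, hy]⟩
      · obtain ⟨w, hw, hwD⟩ := hDd.inter_open_nonempty _
          (Metric.isOpen_ball.inter isClosed_closure.isOpen_compl) ⟨z, hz, fun h => hy (hzy.1 h)⟩
        exact ⟨⟨w, hwD⟩, hw.1, iff_of_false
          (fun h => hw.2 (subset_closure ⟨⟨w, hwD⟩, rfl, h⟩)) hy⟩
    filter_upwards [hmem d] with n hn
    rw [adversarialLoss_eq_one hd (hn.trans hdy)]
    exact (adversarialLoss_mem ε _ _).2
  · push Not at hx
    rw [adversarialLoss_eq_zero fun z hz h => by have := hx z hz; tauto]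
    exact Eventually.of_forall fun n => (adversarialLoss_mem ε _ _).1

/-- A set whose loss is eventually dominated pointwise by the losses of `A n` has risk at most the
limit of the risks of `A n`. -/
lemma adversarialRisk_le_of_tendsto {X : Type*} [MetricSpace X] [MeasurableSpace X] [BorelSpace X]
    {ε : ℝ} {μ : Measure (X × Fin 2)} [IsFiniteMeasure μ] {C : Set X} {A : ℕ → Set X} {m : ℝ}
    (h : ∀ p, ∀ᶠ n in atTop, adversarialLoss ε C p ≤ adversarialLoss ε (A n) p)
    (hA : Tendsto (fun n => adversarialRisk ε μ (A n)) atTop (𝓝 m)) :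
    adversarialRisk ε μ C ≤ m := by
  have hint (n : ℕ) : Integrable
      (fun p => min (adversarialLoss ε C p) (adversarialLoss ε (A n) p)) μ :=
    (integrable_adversarialLoss ε μ C).inf (integrable_adversarialLoss ε μ (A n))
  -- The truncated losses are eventually equal to the loss of `C` at each point.
  have hlim : Tendsto
      (fun n => ∫ p, min (adversarialLoss ε C p) (adversarialLoss ε (A n) p) ∂μ) atTop
      (𝓝 (adversarialRisk ε μ C)) := by
    refine tendsto_integral_of_dominated_convergence (fun _ => 1)
      (fun n => (hint n).aestronglyMeasurable) (integrable_const 1)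
      (fun n => Eventually.of_forall fun p => ?_) (Eventually.of_forall fun p => ?_)
    · rw [Real.norm_eq_abs, abs_of_nonneg
        (le_min (adversarialLoss_mem ε C p).1 (adversarialLoss_mem ε (A n) p).1)]
      exact (min_le_left _ _).trans (adversarialLoss_mem ε C p).2
    · refine tendsto_const_nhds.congr' ?_
      filter_upwards [h p] with n hn
      rw [min_eq_left hn]
  exact le_of_tendsto_of_tendsto' hlim hA fun n =>
    integral_mono (hint n) (integrable_adversarialLoss ε μ (A n)) fun p => min_le_right _ _

/-- On a separable metric space the adversarial risk attains its infimum over all subsets, at a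
closed set. -/
theorem exists_isClosed_adversarialRisk_le {X : Type*} [MetricSpace X]
    [TopologicalSpace.SeparableSpace X] [MeasurableSpace X] [BorelSpace X]
    (μ : Measure (X × Fin 2)) [IsFiniteMeasure μ] (ε : ℝ) :
    ∃ C : Set X, IsClosed C ∧ ∀ B : Set X, adversarialRisk ε μ C ≤ adversarialRisk ε μ B := by
  have hbdd : BddBelow (Set.range (adversarialRisk ε μ)) := by
    refine ⟨0, ?_⟩
    rintro _ ⟨B, rfl⟩
    exact integral_nonneg fun p => (adversarialLoss_mem ε B p).1
  obtain ⟨r, -, hr, hrmem⟩ := exists_seq_tendsto_sInf (Set.range_nonempty _) hbdd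
  choose A hA using hrmem
  obtain ⟨C, hC, φ, hφ, h⟩ := exists_isClosed_subseq_adversarialLoss_le ε A
  refine ⟨C, hC, fun B => le_trans (adversarialRisk_le_of_tendsto h ?_) (csInf_le hbdd ⟨B, rfl⟩)⟩
  simpa only [Function.comp_def, hA] using hr.comp hφ.tendsto_atTop

/-- Existence of minimizers of the adversarial training problem. Here `μ.fst` is the first marginal
`ρ` of the data distribution `μ` on `X × {0, 1}`. -/
theorem mainTheorem1 {X : Type*} [MetricSpace X] [TopologicalSpace.SeparableSpace X]
    [MeasurableSpace X] [BorelSpace X]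
    (μ : Measure (X × Fin 2)) [IsProbabilityMeasure μ]
    (ε : ℝ) (hε : 0 < ε)
    (hν : ∃ ν : Measure X, IsFiniteMeasure ν ∧ μ.fst ≪ ν ∧
      Metric.thickening ε μ.fst.support ⊆ ν.support ∧ IsLocallyDoubling ν) :
    ∃ A : Set X, MeasurableSet A ∧
      ∀ B : Set X, MeasurableSet B → adversarialRisk ε μ A ≤ adversarialRisk ε μ B := by
  obtain ⟨C, hC, h⟩ := exists_isClosed_adversarialRisk_le μ ε
  exact ⟨C, hC.measurableSet, fun B _ => h B⟩
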